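/- Let $\Gamma$ be a cancellation monoid: a monoid, not necessarily commutative, in which $\alpha\alpha_1=\alpha\alpha_2$ implies $\alpha_1=\alpha_2$ and $\alpha_1\alpha=\alpha_2\alpha$ implies $\alpha_1=\alpha_2$. Let $R=\bigoplus_{\alpha\in\Gamma}R_\alpha$ be a $\Gamma$-graded ring: an associative ring with $1$, not necessarily commutative, which is the direct sum of additive subgroups $R_\alpha$ with $R_\alpha R_\beta\subseteq R_{\alpha\beta}$ for all $\alpha,\beta\in\Gamma$. A $\Gamma$-graded left (resp. right) $R$-module is a left (resp. right) $R$-module $M$ which is the direct sum of additive subgroups $M_\alpha$, $\alpha\in\Gamma$, with $R_\alpha M_\beta\subseteq M_{\alpha\beta}$ (resp. $M_\beta R_\alpha\subseteq M_{\beta\alpha}$) for all $\alpha,\beta\in\Gamma$. A homomorphism $f:M\to N$ of $\Gamma$-graded modules is homogeneous if $f(M_\alpha)\subseteq N_\alpha$ for all $\alpha\in\Gamma$. For a $\Gamma$-graded right module $M$ and a $\Gamma$-graded left module $F$, the degree-$\gamma$ part $(M\otimes_R F)_\gamma$ of the abelian group $M\otimes_R F$ is the subgroup generated by all $m\otimes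 x$ with $m\in M_\alpha$, $x\in F_\beta$, $\alpha\beta=\gamma$. A $\Gamma$-graded left $R$-module $F$ is called gr-flat if, for every injective homogeneous homomorphism $f:M\to N$ of $\Gamma$-graded right $R$-modules, the map $f\otimes_R 1_F:M\otimes_R F\to N\otimes_R F$ is homogeneous and injective. Then a $\Gamma$-graded left $R$-module $F$ is gr-flat if and only if $F$ is flat as an ordinary left $R$-module, i.e. if and only if $f\otimes_R 1_F$ is injective for every injective homomorphism $f:M\to N$ of (ungraded) right $R$-modules. -/

import Mathlib

open scoped TensorProduct

/-! Rings and modules graded by a (not necessarily commutative) monoid, the tensor product of a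
right module and a left module over a (not necessarily commutative) ring, flatness and graded
flatness. As usual in Mathlib, a right `R`-module is a `Module Rᵐᵒᵖ M`, and `m r` is written
`MulOpposite.op r • m`. -/

universe w u v t t₁ t₂

namespace MonoidGraded

section Gradings

variable {Γ : Type w} [Monoid Γ] {R : Type u} [Ring R]

open Classical in
/-- The additive subgroups `R_α` make `R` a `Γ`-graded ring: `R` is their internal direct sum and
`R_α R_β ⊆ R_{αβ}`. -/
structure IsGradedRing (𝒜 : Γ → AddSubgroup R) : Prop where
  isInternal : DirectSum.IsInternal 𝒜
  mul_mem : ∀ ⦃α β : Γ⦄ ⦃a b : R⦄, a ∈ 𝒜 α → b ∈ 𝒜 β → a * b ∈ 𝒜 (α * β)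

open Classical in
/-- The additive subgroups `F_β` make the left `R`-module `F` a `Γ`-graded left module: `F` is
their internal direct sum and `R_α F_β ⊆ F_{αβ}`. -/
structure IsGradedLeftModule (𝒜 : Γ → AddSubgroup R) {F : Type v} [AddCommGroup F] [Module R F]
    (ℱ : Γ → AddSubgroup F) : Prop where
  isInternal : DirectSum.IsInternal ℱ
  smul_mem : ∀ ⦃α β : Γ⦄ ⦃a : R⦄ ⦃x : F⦄, a ∈ 𝒜 α → x ∈ ℱ β → a • x ∈ ℱ (α * β)

open Classical in
/-- The additive subgroups `M_β` make the right `R`-module `M` a `Γ`-graded right module: `M` is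
their internal direct sum and `M_β R_α ⊆ M_{βα}`. -/
structure IsGradedRightModule (𝒜 : Γ → AddSubgroup R) {M : Type t} [AddCommGroup M]
    [Module Rᵐᵒᵖ M] (ℳ : Γ → AddSubgroup M) : Prop where
  isInternal : DirectSum.IsInternal ℳ
  smul_mem : ∀ ⦃β α : Γ⦄ ⦃x : M⦄ ⦃a : R⦄,
    x ∈ ℳ β → a ∈ 𝒜 α → MulOpposite.op a • x ∈ ℳ (β * α)

end Gradings

/-- An additive map is homogeneous (of degree the neutral element) if it maps each component into
the component of the same degree. -/
def IsHomogeneousHom {Γ : Type*} {A B : Type*} [AddCommGroup A] [AddCommGroup B]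
    (𝒜 : Γ → AddSubgroup A) (ℬ : Γ → AddSubgroup B) (f : A →+ B) : Prop :=
  ∀ ⦃γ : Γ⦄ ⦃x : A⦄, x ∈ 𝒜 γ → f x ∈ ℬ γ

section Tensor

variable (R : Type*) [Ring R]

/-- The subgroup of `M ⊗_ℤ F` generated by the elements `m r ⊗ x - m ⊗ r x`. -/
def balancedRel (M F : Type*) [AddCommGroup M] [Module Rᵐᵒᵖ M] [AddCommGroup F] [Module R F] :
    AddSubgroup (M ⊗[ℤ] F) :=
  AddSubgroup.closure
    {z | ∃ (m : M) (r : R) (x : F), z = (MulOpposite.op r • m) ⊗ₜ[ℤ] x - m ⊗ₜ[ℤ] (r • x)}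

/-- The tensor product `M ⊗_R F` of a right `R`-module `M` and a left `R`-module `F`, an abelian
group. -/
abbrev Tensor (M F : Type*) [AddCommGroup M] [Module Rᵐᵒᵖ M] [AddCommGroup F] [Module R F] :
    Type _ :=
  (M ⊗[ℤ] F) ⧸ balancedRel R M F

/-- The element `m ⊗ x` of `M ⊗_R F`. -/
def tmul {M F : Type*} [AddCommGroup M] [Module Rᵐᵒᵖ M] [AddCommGroup F] [Module R F]
    (m : M) (x : F) : Tensor R M F :=
  QuotientAddGroup.mk (m ⊗ₜ[ℤ] x)

variable {R}

/-- The additive map `f ⊗ 1 : M ⊗_R F → N ⊗_R F` induced by a homomorphism `f : M → N` of right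
`R`-modules. -/
def rTensor {M N : Type*} [AddCommGroup M] [Module Rᵐᵒᵖ M] [AddCommGroup N] [Module Rᵐᵒᵖ N]
    (F : Type*) [AddCommGroup F] [Module R F] (f : M →ₗ[Rᵐᵒᵖ] N) :
    Tensor R M F →+ Tensor R N F :=
  QuotientAddGroup.map (balancedRel R M F) (balancedRel R N F)
    (LinearMap.rTensor F f.toAddMonoidHom.toIntLinearMap).toAddMonoidHom (by
      refine (AddSubgroup.closure_le _).2 ?_
      rintro z ⟨m, r, x, rfl⟩
      refine AddSubgroup.subset_closure ⟨f m, r, x, ?_⟩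
      simp)

/-- `f ⊗ 1` maps `m ⊗ x` to `f m ⊗ x`. -/
theorem rTensor_tmul {M N F : Type*} [AddCommGroup M] [Module Rᵐᵒᵖ M] [AddCommGroup N]
    [Module Rᵐᵒᵖ N] [AddCommGroup F] [Module R F] (f : M →ₗ[Rᵐᵒᵖ] N) (m : M) (x : F) :
    rTensor F f (tmul R m x) = tmul R (f m) x :=
  rfl

variable (R) in
/-- The degree `γ` component of `M ⊗_R F`: the subgroup generated by the `m ⊗ x` with `m`
homogeneous of degree `α`, `x` homogeneous of degree `β` and `α β = γ`. -/
def tensorGrading {Γ : Type*} [Monoid Γ] {M F : Type*} [AddCommGroup M] [Module Rᵐᵒᵖ M]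
    [AddCommGroup F] [Module R F] (ℳ : Γ → AddSubgroup M) (ℱ : Γ → AddSubgroup F) (γ : Γ) :
    AddSubgroup (Tensor R M F) :=
  AddSubgroup.closure
    {z | ∃ (α β : Γ) (m : M) (x : F), m ∈ ℳ α ∧ x ∈ ℱ β ∧ α * β = γ ∧ z = tmul R m x}

end Tensor

/-- The left `R`-module `F` is flat: `f ⊗ 1 : M ⊗_R F → N ⊗_R F` is injective for every injective
homomorphism `f : M → N` of right `R`-modules (in the universe `t`). -/
def IsFlat (R : Type u) [Ring R] (F : Type v) [AddCommGroup F] [Module R F] : Prop :=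
  ∀ (M N : Type t) [AddCommGroup M] [AddCommGroup N] [Module Rᵐᵒᵖ M] [Module Rᵐᵒᵖ N]
    (f : M →ₗ[Rᵐᵒᵖ] N), Function.Injective f → Function.Injective (rTensor F f)

/-- The graded left `R`-module `F` is gr-flat: `f ⊗ 1 : M ⊗_R F → N ⊗_R F` is a homogeneous
monomorphism for every homogeneous monomorphism `f : M → N` of graded right `R`-modules (in the
universe `t`). -/
def IsGrFlat {Γ : Type w} [Monoid Γ] {R : Type u} [Ring R] (𝒜 : Γ → AddSubgroup R)
    {F : Type v} [AddCommGroup F] [Module R F] (ℱ : Γ → AddSubgroup F) : Prop :=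
  ∀ (M N : Type t) [AddCommGroup M] [AddCommGroup N] [Module Rᵐᵒᵖ M] [Module Rᵐᵒᵖ N]
    (ℳ : Γ → AddSubgroup M) (𝒩 : Γ → AddSubgroup N),
    IsGradedRightModule 𝒜 ℳ → IsGradedRightModule 𝒜 𝒩 →
    ∀ f : M →ₗ[Rᵐᵒᵖ] N, IsHomogeneousHom ℳ 𝒩 f.toAddMonoidHom → Function.Injective f →
      IsHomogeneousHom (tensorGrading R ℳ ℱ) (tensorGrading R 𝒩 ℱ) (rTensor F f) ∧
        Function.Injective (rTensor F f)

end MonoidGraded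

/-!
A gr-flat module satisfies the ordinary equational criterion for flatness, and that criterion, which
mentions no test modules, gives flatness in every universe. The converse is immediate, since
`f ⊗ 1` preserves degrees for every homogeneous `f`.

Suppose `∑ r_i x_i = 0` with the `x_i` homogeneous of degree `β_i` and each `r_i` homogeneous,
carrying degree `β_i` to a common degree `γ`. Gr-flatness, applied to the inclusion of the right
ideal `∑ r_i R` into `R`, gives `∑ r_i ⊗ x_i = 0` over that ideal, and right exactness of the tensor
product (`sum_mem_kernelSpan`) turns this into `x_i = ∑ k_ij y_j` with `∑ r_i k_ij = 0`
and homogeneous `y_j` (`mem_closure_of_sum_smul_eq_zero`). Replacing `k_ij` by its component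
carrying `deg y_j` to `β_i` preserves both equations, by left cancellation
(`exists_homogeneous_of_sum_smul_eq_zero`). Everything is again homogeneous, so finitely many
homogeneous relations can be dealt with in turn (`exists_homogeneous_of_finset`).

A general finite system is reduced to this case by writing the unknowns as sums of homogeneous
elements and splitting each equation by degree (`IsGrFlat.solvesEquationally`). Right cancellation
ensures that the coefficients produced by the splitting are homogeneous
(`exists_mem_of_mem_shiftDegree`). Finally, if `∑ f(m_i) ⊗ x_i = 0` in `N ⊗ F`, a free presentation
of `N` turns this into a finite linear system over `R`; solving it by the criterion yields
`∑ m_i ⊗ x_i = 0` when `f` is injective (`isFlat_of_solvesEquationally`).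
-/

namespace MonoidGraded

/-! ### Gradings of abelian groups -/

section Grading

variable {Γ : Type*} {A B : Type*} [AddCommGroup A] [AddCommGroup B]

open Classical in
theorem iSup_eq_top_of_isInternal {ℬ : Γ → AddSubgroup A} (h : DirectSum.IsInternal ℬ) :
    ⨆ γ, ℬ γ = ⊤ := by
  refine eq_top_iff.2 fun a _ => ?_
  obtain ⟨x, rfl⟩ := h.2 a
  induction x using DirectSum.induction_on with
  | zero => simp
  | of γ x => simpa using AddSubgroup.mem_iSup_of_mem γ x.2
  | add x y hx hy => rw [map_add]; exact AddSubgroup.add_mem _ (hx trivial) (hy trivial)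

theorem homogeneous_induction {ℬ : Γ → AddSubgroup A} (h : ⨆ γ, ℬ γ = ⊤) {p : A → Prop}
    (mem : ∀ γ, ∀ a ∈ ℬ γ, p a) (zero : p 0) (add : ∀ a b, p a → p b → p (a + b)) (a : A) : p a :=
  AddSubgroup.iSup_induction ℬ (C := p) (h ▸ AddSubgroup.mem_top a) mem zero add

open Classical in
/-- The sum of the homogeneous components whose degrees lie in `S`, as an additive endomorphism of
a graded abelian group. -/
noncomputable def projOn (ℬ : Γ → AddSubgroup A) (h : DirectSum.IsInternal ℬ) (S : Set Γ) :
    A →+ A :=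
  (DirectSum.toAddMonoid fun γ => if γ ∈ S then (ℬ γ).subtype else 0).comp
    (AddEquiv.ofBijective (DirectSum.coeAddMonoidHom ℬ) h).symm.toAddMonoidHom

open Classical in
theorem projOn_apply {ℬ : Γ → AddSubgroup A} (h : DirectSum.IsInternal ℬ) (S : Set Γ) {γ : Γ}
    {a : A} (ha : a ∈ ℬ γ) : projOn ℬ h S a = if γ ∈ S then a else 0 := by
  have : (AddEquiv.ofBijective (DirectSum.coeAddMonoidHom ℬ) h).symm a =
      DirectSum.of (fun γ => ℬ γ) γ ⟨a, ha⟩ := by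
    rw [AddEquiv.symm_apply_eq]
    exact (DirectSum.coeAddMonoidHom_of ℬ γ ⟨a, ha⟩).symm
  simp only [projOn, AddMonoidHom.comp_apply, AddEquiv.coe_toAddMonoidHom, this,
    DirectSum.toAddMonoid_of]
  split_ifs <;> simp

open Classical in
/-- A grading pulls back along an injective map as soon as the source is generated by the
elements with homogeneous image. -/
theorem isInternal_comap {ℬ : Γ → AddSubgroup A} (h : DirectSum.IsInternal ℬ) (f : B →+ A)
    (hf : Function.Injective f) (htop : ⨆ γ, (ℬ γ).comap f = ⊤) :
    DirectSum.IsInternal fun γ => (ℬ γ).comap f := by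
  refine ⟨?_, ?_⟩
  · let g : (DirectSum Γ fun γ => (ℬ γ).comap f) →+ DirectSum Γ fun γ => ℬ γ :=
      DirectSum.map fun γ => (f.comp ((ℬ γ).comap f).subtype).codRestrict (ℬ γ) fun x => x.2
    have hg : Function.Injective g := by
      refine (DirectSum.map_injective _).2 fun γ x y hxy => ?_
      exact Subtype.ext (hf (congrArg Subtype.val hxy))
    have hcomp : f.comp (DirectSum.coeAddMonoidHom fun γ => (ℬ γ).comap f) =
        (DirectSum.coeAddMonoidHom ℬ).comp g := by
      ext γ x
      simp only [AddMonoidHom.comp_apply, DirectSum.coeAddMonoidHom_of, g, DirectSum.map_of]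
      rfl
    refine Function.Injective.of_comp (f := f) ?_
    have : (f ∘ DirectSum.coeAddMonoidHom fun γ => (ℬ γ).comap f) =
        DirectSum.coeAddMonoidHom ℬ ∘ g := congrArg DFunLike.coe hcomp
    rw [this]
    exact h.1.comp hg
  · intro b
    refine homogeneous_induction htop (p := fun b => ∃ x, DirectSum.coeAddMonoidHom _ x = b)
      (fun γ b hb => ⟨DirectSum.of (fun γ => (ℬ γ).comap f) γ ⟨b, hb⟩, by simp⟩) ⟨0, by simp⟩ ?_ b
    rintro _ _ ⟨x, rfl⟩ ⟨y, rfl⟩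
    exact ⟨x + y, by simp⟩

end Grading

/-! ### Finite sums of values of a biadditive map -/

section Biadditive

variable {P F Q : Type*} [AddCommGroup P] [AddCommGroup F] [AddCommGroup Q]

theorem exists_fin_sum (μ : P →+ F →+ Q) (K : AddSubgroup P) (H : Set F) {z : Q}
    (hz : z ∈ AddSubgroup.closure {z | ∃ k ∈ K, ∃ y ∈ H, z = μ k y}) :
    ∃ (n : ℕ) (k : Fin n → P) (y : Fin n → F), (∀ j, k j ∈ K) ∧ (∀ j, y j ∈ H) ∧
      z = ∑ j, μ (k j) (y j) := by
  induction hz using AddSubgroup.closure_induction with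
  | mem z hz =>
    obtain ⟨k, hk, y, hy, rfl⟩ := hz
    exact ⟨1, fun _ => k, fun _ => y, fun _ => hk, fun _ => hy, by simp⟩
  | zero => exact ⟨0, Fin.elim0, Fin.elim0, fun j => j.elim0, fun j => j.elim0, by simp⟩
  | add z z' _ _ h h' =>
    obtain ⟨n, k, y, hk, hy, rfl⟩ := h
    obtain ⟨n', k', y', hk', hy', rfl⟩ := h'
    refine ⟨n + n', Fin.append k k', Fin.append y y', fun j => ?_, fun j => ?_, ?_⟩
    · refine Fin.addCases (fun i => ?_) (fun i => ?_) j
      · simpa using hk i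
      · simpa using hk' i
    · refine Fin.addCases (fun i => ?_) (fun i => ?_) j
      · simpa using hy i
      · simpa using hy' i
    · simp [Fin.sum_univ_add]
  | neg z _ h =>
    obtain ⟨n, k, y, hk, hy, rfl⟩ := h
    exact ⟨n, fun j => -k j, y, fun j => K.neg_mem (hk j), hy, by simp⟩

/-- If `F` is graded, the second arguments can be taken homogeneous. -/
theorem exists_fin_sum_homogeneous {Γ : Type*} {ℱ : Γ → AddSubgroup F} (h : ⨆ γ, ℱ γ = ⊤)
    (μ : P →+ F →+ Q) (K : AddSubgroup P) {z : Q}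
    (hz : z ∈ AddSubgroup.closure {z | ∃ k ∈ K, ∃ y, z = μ k y}) :
    ∃ (n : ℕ) (k : Fin n → P) (y : Fin n → F) (δ : Fin n → Γ), (∀ j, k j ∈ K) ∧
      (∀ j, y j ∈ ℱ (δ j)) ∧ z = ∑ j, μ (k j) (y j) := by
  have hle : AddSubgroup.closure {z | ∃ k ∈ K, ∃ y, z = μ k y} ≤
      AddSubgroup.closure {z | ∃ k ∈ K, ∃ y ∈ {y | ∃ γ, y ∈ ℱ γ}, z = μ k y} := by
    refine (AddSubgroup.closure_le _).2 ?_
    rintro _ ⟨k, hk, y, rfl⟩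
    refine homogeneous_induction h (p := fun y => μ k y ∈ AddSubgroup.closure _) ?_ ?_ ?_ y
    · exact fun γ y hy => AddSubgroup.subset_closure ⟨k, hk, y, ⟨γ, hy⟩, rfl⟩
    · rw [map_zero]
      exact AddSubgroup.zero_mem _
    · intro a b ha hb
      rw [map_add]
      exact AddSubgroup.add_mem _ ha hb
  obtain ⟨n, k, y, hk, hy, rfl⟩ := exists_fin_sum μ K _ (hle hz)
  choose δ hδ using hy
  exact ⟨n, k, y, δ, hk, hδ, rfl⟩

end Biadditive

/-! ### The tensor product of a right and a left module -/

section Tensor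

variable {R : Type*} [Ring R]

section

variable {M F : Type*} [AddCommGroup M] [Module Rᵐᵒᵖ M] [AddCommGroup F] [Module R F]

variable (R M F) in
/-- The biadditive map `(m, x) ↦ m ⊗ x`. -/
def tmulHom : M →+ F →+ Tensor R M F :=
  AddMonoidHom.mk' (fun m => AddMonoidHom.mk' (fun x => tmul R m x) fun x y => by
    simp [tmul, TensorProduct.tmul_add]) fun m n => by
    ext x
    simp [tmul, TensorProduct.add_tmul]

@[simp]
theorem tmulHom_apply (m : M) (x : F) : tmulHom R M F m x = tmul R m x :=
  rfl

theorem smul_tmul (m : M) (r : R) (x : F) :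
    tmul R (MulOpposite.op r • m) x = tmul R m (r • x) :=
  QuotientAddGroup.eq_iff_sub_mem.2 (AddSubgroup.subset_closure ⟨m, r, x, rfl⟩)

theorem exists_sum_tmul (z : Tensor R M F) :
    ∃ (n : ℕ) (m : Fin n → M) (x : Fin n → F), z = ∑ i, tmul R (m i) (x i) := by
  obtain ⟨z, rfl⟩ := QuotientAddGroup.mk_surjective z
  have : (z : Tensor R M F) ∈ AddSubgroup.closure
      {z | ∃ m ∈ (⊤ : AddSubgroup M), ∃ x ∈ (Set.univ : Set F), z = tmulHom R M F m x} := by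
    induction z using TensorProduct.induction_on with
    | zero => exact AddSubgroup.zero_mem _
    | tmul m x => exact AddSubgroup.subset_closure ⟨m, trivial, x, trivial, rfl⟩
    | add a b ha hb => exact AddSubgroup.add_mem _ ha hb
  obtain ⟨n, m, x, -, -, h⟩ := exists_fin_sum _ _ _ this
  exact ⟨n, m, x, h⟩

/-- The universal property of `M ⊗_R F`. -/
theorem exists_lift {Q : Type*} [AddCommGroup Q] (b : M →+ F →+ Q)
    (hb : ∀ m (r : R) x, b (MulOpposite.op r • m) x = b m (r • x)) :
    ∃ Φ : Tensor R M F →+ Q, ∀ m x, Φ (tmul R m x) = b m x := by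
  let g : M ⊗[ℤ] F →+ Q := TensorProduct.liftAddHom b fun n m x => by simp
  refine ⟨QuotientAddGroup.lift (balancedRel R M F) g ?_, fun m x => ?_⟩
  · refine (AddSubgroup.closure_le _).2 ?_
    rintro _ ⟨m, r, x, rfl⟩
    simp [g, hb]
  · change g (m ⊗ₜ[ℤ] x) = b m x
    simp [g]

/-- The subgroup of `Q` generated by the `μ k y` with `k` in the kernel of `φ`. -/
def kernelSpan {P Q : Type*} [AddCommGroup P] [Module Rᵐᵒᵖ P] [AddCommGroup Q]
    (φ : P →ₗ[Rᵐᵒᵖ] M) (μ : P →+ F →+ Q) : AddSubgroup Q :=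
  AddSubgroup.closure {z | ∃ k ∈ φ.toAddMonoidHom.ker, ∃ y, z = μ k y}

/-- Right exactness of the tensor product, in the form needed here: if `φ : P → M` is surjective
and `μ` is a balanced map on `P × F` (in practice `P` is free and `μ` identifies its target with
`P ⊗_R F`), then an element vanishing in `M ⊗_R F` comes from the kernel of `φ`. -/
theorem sum_mem_kernelSpan {P Q : Type*} [AddCommGroup P] [Module Rᵐᵒᵖ P] [AddCommGroup Q]
    (φ : P →ₗ[Rᵐᵒᵖ] M) (hφ : Function.Surjective φ) (μ : P →+ F →+ Q)
    (hμ : ∀ p (r : R) y, μ (MulOpposite.op r • p) y = μ p (r • y)) {ι : Type*} [Fintype ι]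
    (p : ι → P) (x : ι → F) (h : ∑ i, tmul R (φ (p i)) (x i) = 0) :
    ∑ i, μ (p i) (x i) ∈ kernelSpan φ μ := by
  let q : Q →+ Q ⧸ kernelSpan φ μ := QuotientAddGroup.mk' _
  have hq : ∀ p p' y, φ p = φ p' → q (μ p y) = q (μ p' y) := by
    intro p p' y hp
    refine QuotientAddGroup.eq_iff_sub_mem.2 (AddSubgroup.subset_closure ⟨p - p', ?_, y, ?_⟩)
    · simp [AddMonoidHom.mem_ker, hp]
    · simp
  let s := Function.surjInv hφ
  have hs : ∀ m, φ (s m) = m := Function.surjInv_eq hφ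
  -- The choice of preimages is not additive, but becomes so modulo `kernelSpan φ μ`.
  let b : M →+ F →+ Q ⧸ kernelSpan φ μ :=
    AddMonoidHom.mk' (fun m => q.comp (μ (s m))) fun m m' => by
      ext y
      simp only [AddMonoidHom.comp_apply, AddMonoidHom.add_apply]
      rw [hq (s (m + m')) (s m + s m') y (by simp [hs])]
      simp
  obtain ⟨Φ, hΦ⟩ := exists_lift (R := R) b fun m r y => by
    change q (μ (s (MulOpposite.op r • m)) y) = q (μ (s m) (r • y))
    rw [← hμ]
    exact hq _ _ _ (by simp [hs])
  have h0 := congrArg Φ h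
  simp only [map_sum, map_zero, hΦ] at h0
  refine (QuotientAddGroup.eq_zero_iff _).1 ?_
  change q (∑ i, μ (p i) (x i)) = 0
  rw [map_sum, ← h0]
  exact Finset.sum_congr rfl fun i _ => hq _ _ _ (hs _).symm

end

end Tensor

/-! ### The equational criterion for flatness -/

section Criterion

variable (R : Type*) [Ring R] (F : Type*) [AddCommGroup F] [Module R F]

/-- The equational criterion: every solution `x` in `F` of a finite system `S` of homogeneous
linear equations over `R` is a combination, with coefficients in `F`, of solutions in `R`. -/
def SolvesEquationally : Prop :=
  ∀ (ι : Type) [Fintype ι] (S : Finset (ι → R)) (x : ι → F), (∀ s ∈ S, ∑ i, s i • x i = 0) →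
    ∃ (n : ℕ) (A : ι → Fin n → R) (y : Fin n → F), (∀ i, x i = ∑ j, A i j • y j) ∧
      ∀ s ∈ S, ∀ j, ∑ i, s i * A i j = 0

variable {R F}

open Classical in
theorem isFlat_of_solvesEquationally (h : SolvesEquationally R F) : IsFlat R F := by
  intro M N _ _ _ _ f hf
  refine (injective_iff_map_eq_zero _).2 fun z hz => ?_
  obtain ⟨n, m, x, rfl⟩ := exists_sum_tmul z
  simp only [map_sum, rTensor_tmul] at hz
  -- Compute in `N ⊗ F` with the presentation of `N` on the free right module with basis `N`.
  let φ : (N →₀ R) →ₗ[Rᵐᵒᵖ] N :=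
    { toFun := fun p => p.sum fun ν r => MulOpposite.op r • ν
      map_add' := fun p p' => Finsupp.sum_add_index' (by simp) (by simp [add_smul])
      map_smul' := fun r p => by
        rw [Finsupp.sum_smul_index' (by simp), RingHom.id_apply, Finsupp.smul_sum]
        refine Finset.sum_congr rfl fun ν _ => ?_
        exact mul_smul r (MulOpposite.op (p ν)) ν }
  have hφs : ∀ ν r, φ (Finsupp.single ν r) = MulOpposite.op r • ν := fun ν r =>
    Finsupp.sum_single_index (h := fun ν r => MulOpposite.op r • ν) (by simp)
  let μ : (N →₀ R) →+ F →+ (N →₀ F) :=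
    AddMonoidHom.mk' (fun p => AddMonoidHom.mk'
      (fun y => p.mapRange (fun r => r • y) (zero_smul R y)) fun y y' => by ext; simp) fun p p' => by
      ext; simp [add_smul]
  have hμ : ∀ p y ν, μ p y ν = p ν • y := fun p y ν => rfl
  have hmem := sum_mem_kernelSpan φ (fun ν => ⟨Finsupp.single ν 1, by simp [hφs]⟩) μ
    (fun p r y => Finsupp.ext fun ν => mul_smul (p ν) r y) (fun i => Finsupp.single (f (m i)) 1) x
    (by simpa [hφs] using hz)
  obtain ⟨n', k, y, hk, -, hxy⟩ := exists_fin_sum μ φ.toAddMonoidHom.ker Set.univ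
    (by simpa [kernelSpan] using hmem)
  let s : N → Fin n ⊕ Fin n' → R := fun ν =>
    Sum.elim (fun i => Finsupp.single (f (m i)) (1 : R) ν) fun j => -k j ν
  let T : Finset N := Finset.univ.image (fun i => f (m i)) ∪ Finset.univ.biUnion fun j =>
    (k j).support
  obtain ⟨l, A, w, hA, hs⟩ := h (Fin n ⊕ Fin n') (T.image s) (Sum.elim x y) (by
    simp only [Finset.mem_image, forall_exists_index, and_imp, forall_apply_eq_imp_iff₂]
    intro ν _
    have := DFunLike.congr_fun hxy ν
    simp only [Finsupp.finsetSum_apply, hμ] at this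
    simp [s, this])
  -- Outside `T` all coefficients vanish, so the equations hold at every `ν`.
  have hs' : ∀ ν t, ∑ i, s ν i * A i t = 0 := by
    intro ν t
    by_cases hν : ν ∈ T
    · exact hs _ (Finset.mem_image_of_mem _ hν) t
    · refine Finset.sum_eq_zero fun i _ => ?_
      simp only [T, Finset.mem_union, Finset.mem_image, Finset.mem_biUnion, Finset.mem_univ,
        true_and, not_or, not_exists, Finsupp.mem_support_iff, not_not] at hν
      rcases i with i | j
      · simp [s, Finsupp.single_eq_of_ne' (hν.1 i)]
      · simp [s, hν.2 j]
  have hrel : ∀ t, ∑ i, MulOpposite.op (A (Sum.inl i) t) • m i = 0 := by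
    intro t
    apply hf
    have hP : ∑ i, Finsupp.single (f (m i)) (A (Sum.inl i) t) =
        ∑ j, MulOpposite.op (A (Sum.inr j) t) • k j := by
      ext ν
      have := hs' ν t
      simp only [s, Fintype.sum_sum_type, Sum.elim_inl, Sum.elim_inr, neg_mul,
        Finset.sum_neg_distrib, add_neg_eq_zero] at this
      simp only [Finsupp.finsetSum_apply, Finsupp.smul_apply, MulOpposite.smul_eq_mul_unop,
        MulOpposite.unop_op]
      rw [← this]
      refine Finset.sum_congr rfl fun i _ => ?_
      simp [Finsupp.single_apply]
    have := congrArg φ hP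
    simp only [map_sum, hφs, map_smul] at this
    rw [map_sum, map_zero]
    simp only [map_smul]
    rw [this]
    refine Finset.sum_eq_zero fun j _ => ?_
    have hkj : φ (k j) = 0 := hk j
    rw [hkj, smul_zero]
  have hx : ∀ i, x i = ∑ t, A (Sum.inl i) t • w t := fun i => hA (Sum.inl i)
  calc ∑ i, tmul R (m i) (x i)
      = ∑ i, ∑ t, tmulHom R M F (MulOpposite.op (A (Sum.inl i) t) • m i) (w t) := by
        refine Finset.sum_congr rfl fun i _ => ?_
        rw [hx i, ← tmulHom_apply, map_sum]
        exact Finset.sum_congr rfl fun t _ => (smul_tmul _ _ _).symm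
    _ = ∑ t, tmulHom R M F (∑ i, MulOpposite.op (A (Sum.inl i) t) • m i) (w t) := by
        rw [Finset.sum_comm]
        refine Finset.sum_congr rfl fun t _ => ?_
        rw [map_sum, AddMonoidHom.finsetSum_apply]
    _ = 0 := by simp [hrel]

end Criterion

/-! ### Homogeneous linear relations -/

section Graded

variable {Γ : Type w} [Monoid Γ] {R : Type u} [Ring R] {𝒜 : Γ → AddSubgroup R}
  {F : Type v} [AddCommGroup F] [Module R F] {ℱ : Γ → AddSubgroup F}

theorem IsFlat.isGrFlat (h : IsFlat.{u, v, t} R F) : IsGrFlat.{w, u, v, t} 𝒜 ℱ := by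
  intro M N _ _ _ _ ℳ 𝒩 _ _ f hf hinj
  refine ⟨fun γ z hz => ?_, h M N f hinj⟩
  have hle : tensorGrading R ℳ ℱ γ ≤ (tensorGrading R 𝒩 ℱ γ).comap (rTensor F f) := by
    refine (AddSubgroup.closure_le _).2 ?_
    rintro _ ⟨α, β, m, x, hm, hx, hαβ, rfl⟩
    exact AddSubgroup.subset_closure ⟨α, β, f m, x, hf hm, hx, hαβ, rfl⟩
  exact hle hz

/-- The coefficients that carry degree `β` to degree `γ`: sums of elements of the `R_α` with
`α β = γ`. -/
def shiftDegree (𝒜 : Γ → AddSubgroup R) (γ β : Γ) : AddSubgroup R :=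
  AddSubgroup.closure {a | ∃ α, α * β = γ ∧ a ∈ 𝒜 α}

/-- By right cancellation at most one `α` satisfies `α β = γ`. -/
theorem exists_mem_of_mem_shiftDegree [IsRightCancelMul Γ] {γ β : Γ} {a : R}
    (ha : a ∈ shiftDegree 𝒜 γ β) : ∃ α, a ∈ 𝒜 α := by
  suffices h : a = 0 ∨ ∃ α, α * β = γ ∧ a ∈ 𝒜 α by
    rcases h with rfl | ⟨α, -, h⟩
    · exact ⟨1, AddSubgroup.zero_mem _⟩
    · exact ⟨α, h⟩
  induction ha using AddSubgroup.closure_induction with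
  | mem a ha => exact Or.inr ha
  | zero => exact Or.inl rfl
  | add a b _ _ ha hb =>
    rcases ha with rfl | ⟨α, hα, ha⟩
    · simpa using hb
    rcases hb with rfl | ⟨α', hα', hb⟩
    · exact Or.inr ⟨α, hα, by simpa using ha⟩
    obtain rfl : α = α' := mul_right_cancel (hα.trans hα'.symm)
    exact Or.inr ⟨α, hα, AddSubgroup.add_mem _ ha hb⟩
  | neg a _ ha =>
    rcases ha with rfl | ⟨α, hα, ha⟩
    · exact Or.inl neg_zero
    · exact Or.inr ⟨α, hα, AddSubgroup.neg_mem _ ha⟩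

theorem mul_mem_shiftDegree (h𝒜 : IsGradedRing 𝒜) {γ β δ : Γ} {a b : R}
    (ha : a ∈ shiftDegree 𝒜 γ β) (hb : b ∈ shiftDegree 𝒜 β δ) : a * b ∈ shiftDegree 𝒜 γ δ := by
  induction ha using AddSubgroup.closure_induction with
  | mem a ha =>
    obtain ⟨α, rfl, ha⟩ := ha
    induction hb using AddSubgroup.closure_induction with
    | mem b hb =>
      obtain ⟨ε, rfl, hb⟩ := hb
      exact AddSubgroup.subset_closure ⟨α * ε, mul_assoc _ _ _, h𝒜.mul_mem ha hb⟩
    | zero => simp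
    | add b b' _ _ h h' => rw [mul_add]; exact AddSubgroup.add_mem _ h h'
    | neg b _ h => rw [mul_neg]; exact AddSubgroup.neg_mem _ h
  | zero => simp
  | add a a' _ _ h h' => rw [add_mul]; exact AddSubgroup.add_mem _ h h'
  | neg a _ h => rw [neg_mul]; exact AddSubgroup.neg_mem _ h

/-- The component of an element of `R` that carries degree `β` to degree `γ`. -/
noncomputable def shiftProj (h𝒜 : IsGradedRing 𝒜) (γ β : Γ) : R →+ R :=
  projOn 𝒜 h𝒜.isInternal {α | α * β = γ}

theorem shiftProj_mem (h𝒜 : IsGradedRing 𝒜) (γ β : Γ) (a : R) :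
    shiftProj h𝒜 γ β a ∈ shiftDegree 𝒜 γ β := by
  refine homogeneous_induction (iSup_eq_top_of_isInternal h𝒜.isInternal)
    (p := fun a => shiftProj h𝒜 γ β a ∈ shiftDegree 𝒜 γ β) ?_ ?_ ?_ a
  · intro α a ha
    rw [shiftProj, projOn_apply _ _ ha]
    split_ifs with h
    · exact AddSubgroup.subset_closure ⟨α, h, ha⟩
    · exact AddSubgroup.zero_mem _
  · simp
  · intro a b ha hb
    rw [map_add]
    exact AddSubgroup.add_mem _ ha hb

theorem projOn_smul (h𝒜 : IsGradedRing 𝒜) (hℱ : IsGradedLeftModule 𝒜 ℱ) (γ : Γ) {δ : Γ} (a : R)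
    {y : F} (hy : y ∈ ℱ δ) :
    projOn ℱ hℱ.isInternal {γ} (a • y) = shiftProj h𝒜 γ δ a • y := by
  classical
  refine homogeneous_induction (iSup_eq_top_of_isInternal h𝒜.isInternal)
    (p := fun a => projOn ℱ hℱ.isInternal {γ} (a • y) = shiftProj h𝒜 γ δ a • y) ?_ ?_ ?_ a
  · intro α a ha
    rw [shiftProj, projOn_apply _ _ ha, projOn_apply _ _ (hℱ.smul_mem ha hy)]
    by_cases h : α * δ = γ <;> simp [h]
  · simp
  · intro a b ha hb
    simp [add_smul, ha, hb]

/-- This is where left cancellation enters: for `r` in `R_α` and `k` in `R_ε`, the product `r k`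
carries degree `δ` to degree `α β` only if `k` carries degree `δ` to degree `β`. -/
theorem mul_shiftProj [IsLeftCancelMul Γ] (h𝒜 : IsGradedRing 𝒜) {γ β : Γ} (δ : Γ) {r : R}
    (hr : r ∈ shiftDegree 𝒜 γ β) (k : R) :
    r * shiftProj h𝒜 β δ k = shiftProj h𝒜 γ δ (r * k) := by
  classical
  induction hr using AddSubgroup.closure_induction with
  | mem r hr =>
    obtain ⟨α, rfl, hr⟩ := hr
    refine homogeneous_induction (iSup_eq_top_of_isInternal h𝒜.isInternal)
      (p := fun k => r * shiftProj h𝒜 β δ k = shiftProj h𝒜 (α * β) δ (r * k)) ?_ ?_ ?_ k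
    · intro ε k hk
      rw [shiftProj, shiftProj, projOn_apply _ _ hk, projOn_apply _ _ (h𝒜.mul_mem hr hk)]
      have : α * ε * δ = α * β ↔ ε * δ = β := by rw [mul_assoc, mul_right_inj]
      by_cases h : ε * δ = β <;> simp [this, h]
    · simp
    · intro a b ha hb
      simp [mul_add, ha, hb]
  | zero => simp
  | add a b _ _ ha hb => simp [add_mul, ha, hb]
  | neg a _ ha => simp [ha]

theorem exists_sum_shiftProj (h𝒜 : IsGradedRing 𝒜) (δ : Γ) (a : R) :
    ∃ T : Finset Γ, ∀ T', T ⊆ T' → ∑ γ ∈ T', shiftProj h𝒜 γ δ a = a := by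
  classical
  refine homogeneous_induction (iSup_eq_top_of_isInternal h𝒜.isInternal)
    (p := fun a => ∃ T : Finset Γ, ∀ T', T ⊆ T' → ∑ γ ∈ T', shiftProj h𝒜 γ δ a = a) ?_ ?_ ?_ a
  · intro α a ha
    refine ⟨{α * δ}, fun T' hT' => ?_⟩
    have : α * δ ∈ T' := by simpa using hT'
    simp [shiftProj, projOn_apply _ _ ha, this]
  · exact ⟨∅, by simp⟩
  · rintro a b ⟨T, hT⟩ ⟨U, hU⟩
    refine ⟨T ∪ U, fun T' hT' => ?_⟩
    simp only [map_add, Finset.sum_add_distrib]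
    rw [hT _ (Finset.union_subset_left hT'), hU _ (Finset.union_subset_right hT')]

/-- The evaluation `(p, y) ↦ (p_i y)_i`, which identifies `R^ι ⊗_R F` with `F^ι`. -/
def piSMul (R F : Type*) [Ring R] [AddCommGroup F] [Module R F] (ι : Type*) :
    (ι → R) →+ F →+ (ι → F) :=
  AddMonoidHom.mk' (fun p => AddMonoidHom.mk' (fun y i => p i • y) fun y y' => by ext; simp)
    fun p p' => by ext; simp [add_smul]

@[simp]
theorem piSMul_apply {ι : Type*} (p : ι → R) (y : F) (i : ι) : piSMul R F ι p y i = p i • y :=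
  rfl

theorem sum_piSMul_single {ι : Type*} [Fintype ι] [DecidableEq ι] (x : ι → F) :
    ∑ i, piSMul R F ι (Pi.single i 1) (x i) = x := by
  ext i
  rw [Finset.sum_apply, Finset.sum_eq_single i]
  · simp
  · intro j _ hj
    simp [Pi.single_eq_of_ne hj.symm]
  · simp

/-- In a gr-flat module, a relation with homogeneous coefficients comes from relations in `R`.
The graded modules to which gr-flatness is applied are the right ideal generated by the
coefficients and the ring itself. -/
theorem mem_closure_of_sum_smul_eq_zero (h𝒜 : IsGradedRing 𝒜)
    (hF : IsGrFlat.{w, u, v, max u t} 𝒜 ℱ) {ι : Type} [Fintype ι] (r : ι → R)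
    (hr : ∀ i, ∃ α, r i ∈ 𝒜 α) (x : ι → F) (h : ∑ i, r i • x i = 0)
    (K : AddSubgroup (ι → R)) (hK : ∀ k, k ∈ K ↔ ∑ i, r i * k i = 0) :
    x ∈ AddSubgroup.closure {z | ∃ k ∈ K, ∃ y, z = piSMul R F ι k y} := by
  classical
  let φ₀ : (ι → R) →ₗ[Rᵐᵒᵖ] R :=
    { toFun := fun p => ∑ i, r i * p i
      map_add' := fun p p' => by simp [mul_add, Finset.sum_add_distrib]
      map_smul' := fun a p => by simp [Finset.sum_mul, mul_assoc] }
  let I := LinearMap.range φ₀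
  let f : ULift.{t} I →ₗ[Rᵐᵒᵖ] ULift.{t} R :=
    ULift.moduleEquiv.symm.toLinearMap ∘ₗ I.subtype ∘ₗ ULift.moduleEquiv.toLinearMap
  let φ : (ι → R) →ₗ[Rᵐᵒᵖ] ULift.{t} I := ULift.moduleEquiv.symm.toLinearMap ∘ₗ φ₀.rangeRestrict
  let dR : ULift.{t} R →+ R := AddEquiv.ulift.toAddMonoidHom
  let dI : ULift.{t} I →+ R := dR.comp f.toAddMonoidHom
  have hdR : Function.Injective dR := ULift.down_injective
  have hf : Function.Injective f := fun a b hab =>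
    ULift.down_injective (Subtype.ext (congrArg ULift.down hab))
  have hφ : Function.Surjective φ :=
    ULift.moduleEquiv.symm.surjective.comp φ₀.surjective_rangeRestrict
  have hdφ : ∀ p, dI (φ p) = ∑ i, r i * p i := fun p => rfl
  have htopR : ⨆ γ, (𝒜 γ).comap dR = ⊤ := by
    refine eq_top_iff.2 fun a _ => ?_
    obtain ⟨a⟩ := a
    refine homogeneous_induction (iSup_eq_top_of_isInternal h𝒜.isInternal)
      (p := fun a => ULift.up a ∈ ⨆ γ, (𝒜 γ).comap dR) ?_ ?_ ?_ a
    · exact fun γ a ha => AddSubgroup.mem_iSup_of_mem γ ha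
    · exact AddSubgroup.zero_mem _
    · exact fun a b ha hb => AddSubgroup.add_mem _ ha hb
  have htopI : ⨆ γ, (𝒜 γ).comap dI = ⊤ := by
    refine eq_top_iff.2 fun b _ => ?_
    obtain ⟨p, rfl⟩ := hφ b
    have hp : p = ∑ i, Pi.single i (p i) := (Finset.univ_sum_single p).symm
    rw [hp, map_sum]
    refine AddSubgroup.sum_mem _ fun i _ => ?_
    obtain ⟨α, hα⟩ := hr i
    refine homogeneous_induction (iSup_eq_top_of_isInternal h𝒜.isInternal)
      (p := fun a => φ (Pi.single i a) ∈ ⨆ γ, (𝒜 γ).comap dI) ?_ ?_ ?_ (p i)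
    · intro ε a ha
      refine AddSubgroup.mem_iSup_of_mem (α * ε) ?_
      rw [AddSubgroup.mem_comap, hdφ, Finset.sum_eq_single i (by
        intro j _ hj; simp [Pi.single_eq_of_ne hj]) (by simp)]
      simpa using h𝒜.mul_mem hα ha
    · simp
    · intro a b ha hb
      rw [Pi.single_add, map_add]
      exact AddSubgroup.add_mem _ ha hb
  have hI : IsGradedRightModule 𝒜 fun γ => (𝒜 γ).comap dI :=
    ⟨isInternal_comap h𝒜.isInternal dI (hdR.comp hf) htopI, fun _ _ _ _ hx ha =>
      h𝒜.mul_mem hx ha⟩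
  have hRg : IsGradedRightModule 𝒜 fun γ => (𝒜 γ).comap dR :=
    ⟨isInternal_comap h𝒜.isInternal dR hdR htopR, fun _ _ _ _ hx ha => h𝒜.mul_mem hx ha⟩
  have hinj := (hF _ _ _ _ hI hRg f (fun _ _ hx => hx) hf).2
  have hz : ∑ i, tmul R (φ (Pi.single i 1)) (x i) = 0 := by
    refine (injective_iff_map_eq_zero _).1 hinj _ ?_
    have hfi : ∀ i, f (φ (Pi.single i 1)) = MulOpposite.op (r i) • ULift.up 1 := by
      intro i
      apply hdR
      change dI (φ (Pi.single i 1)) = 1 * r i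
      rw [hdφ]
      simp [Pi.single_apply]
    simp only [map_sum, rTensor_tmul, hfi, smul_tmul]
    simp only [← tmulHom_apply]
    rw [← map_sum, h, map_zero]
  have hmem := sum_mem_kernelSpan φ hφ (piSMul R F ι)
    (fun p a y => by ext i; simp [mul_smul]) (fun i => Pi.single i 1) x hz
  rw [sum_piSMul_single] at hmem
  refine AddSubgroup.closure_mono ?_ hmem
  rintro _ ⟨k, hk, y, rfl⟩
  refine ⟨k, (hK k).2 ?_, y, rfl⟩
  have : φ k = 0 := hk
  rw [← hdφ, this, map_zero]

/-- The graded equational criterion for one relation of degree `γ` between homogeneous elements: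
the new coefficients and the new elements can be taken homogeneous of matching degrees. -/
theorem exists_homogeneous_of_sum_smul_eq_zero [IsCancelMul Γ] (h𝒜 : IsGradedRing 𝒜)
    (hℱ : IsGradedLeftModule 𝒜 ℱ) (hF : IsGrFlat.{w, u, v, max u t} 𝒜 ℱ) {ι : Type} [Fintype ι]
    (r : ι → R) (x : ι → F) (β : ι → Γ) (γ : Γ) (hr : ∀ i, r i ∈ shiftDegree 𝒜 γ (β i))
    (hx : ∀ i, x i ∈ ℱ (β i)) (h : ∑ i, r i • x i = 0) :
    ∃ (n : ℕ) (A : ι → Fin n → R) (y : Fin n → F) (δ : Fin n → Γ),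
      (∀ j, y j ∈ ℱ (δ j)) ∧ (∀ i j, A i j ∈ shiftDegree 𝒜 (β i) (δ j)) ∧
      (∀ i, x i = ∑ j, A i j • y j) ∧ ∀ j, ∑ i, r i * A i j = 0 := by
  classical
  let K : AddSubgroup (ι → R) :=
    { carrier := {k | ∑ i, r i * k i = 0}
      add_mem' := fun {a b} ha hb => by
        simp only [Set.mem_ofPred_eq] at ha hb
        simp [mul_add, Finset.sum_add_distrib, ha, hb]
      zero_mem' := by simp
      neg_mem' := fun {a} ha => by
        simp only [Set.mem_ofPred_eq] at ha
        simp [ha] }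
  have hmem := mem_closure_of_sum_smul_eq_zero.{w, u, v, t} h𝒜 hF r
    (fun i => exists_mem_of_mem_shiftDegree (hr i)) x h K fun _ => Iff.rfl
  obtain ⟨n, k, y, δ, hk, hy, hxy⟩ := exists_fin_sum_homogeneous
    (iSup_eq_top_of_isInternal hℱ.isInternal) (piSMul R F ι) K hmem
  -- Only the components of the coefficients that match the degrees are kept.
  refine ⟨n, fun i j => shiftProj h𝒜 (β i) (δ j) (k j i), y, δ, hy,
    fun i j => shiftProj_mem _ _ _ _, fun i => ?_, fun j => ?_⟩
  · have hxi : x i = ∑ j, k j i • y j := by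
      have := congrFun hxy i
      simpa using this
    have hp : projOn ℱ hℱ.isInternal {β i} (x i) = x i := by
      rw [projOn_apply _ _ (hx i), if_pos (Set.mem_singleton _)]
    rw [← hp]
    conv_lhs => rw [hxi]
    rw [map_sum]
    exact Finset.sum_congr rfl fun j _ => projOn_smul h𝒜 hℱ _ _ (hy j)
  · have hkj : ∑ i, r i * k j i = 0 := hk j
    simp only [mul_shiftProj h𝒜 (δ j) (hr _)]
    rw [← map_sum, hkj, map_zero]

/-- The graded equational criterion for finitely many homogeneous relations, by treating them one
after the other: right multiplication by the coefficients already found turns the next relation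
into a homogeneous relation between the new elements. -/
theorem exists_homogeneous_of_finset [IsCancelMul Γ] (h𝒜 : IsGradedRing 𝒜)
    (hℱ : IsGradedLeftModule 𝒜 ℱ) (hF : IsGrFlat.{w, u, v, max u t} 𝒜 ℱ) {ι : Type} [Fintype ι]
    (x : ι → F) (β : ι → Γ) (hx : ∀ i, x i ∈ ℱ (β i)) (S : Finset (ι → R))
    (hS : ∀ s ∈ S, (∃ γ, ∀ i, s i ∈ shiftDegree 𝒜 γ (β i)) ∧ ∑ i, s i • x i = 0) :
    ∃ (n : ℕ) (A : ι → Fin n → R) (y : Fin n → F) (δ : Fin n → Γ),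
      (∀ j, y j ∈ ℱ (δ j)) ∧ (∀ i j, A i j ∈ shiftDegree 𝒜 (β i) (δ j)) ∧
      (∀ i, x i = ∑ j, A i j • y j) ∧ ∀ s ∈ S, ∀ j, ∑ i, s i * A i j = 0 := by
  classical
  induction S using Finset.induction_on with
  | empty =>
    obtain ⟨n, A, y, δ, hy, hA, hxy, -⟩ := exists_homogeneous_of_sum_smul_eq_zero.{w, u, v, t}
      h𝒜 hℱ hF (fun _ => 0) x β 1 (fun _ => AddSubgroup.zero_mem _) hx (by simp)
    exact ⟨n, A, y, δ, hy, hA, hxy, by simp⟩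
  | insert s S _ ih =>
    obtain ⟨n, A, y, δ, hy, hA, hxy, hSA⟩ :=
      ih fun s hs => hS s (Finset.mem_insert_of_mem hs)
    obtain ⟨⟨γ, hγ⟩, hsx⟩ := hS s (Finset.mem_insert_self _ _)
    obtain ⟨l, B, z, ε, hz, hB, hyz, hsB⟩ := exists_homogeneous_of_sum_smul_eq_zero.{w, u, v, t}
      h𝒜 hℱ hF (fun j => ∑ i, s i * A i j) y δ γ
      (fun j => AddSubgroup.sum_mem _ fun i _ => mul_mem_shiftDegree h𝒜 (hγ i) (hA i j)) hy (by
        rw [← hsx]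
        simp only [hxy, Finset.smul_sum, Finset.sum_smul, mul_smul]
        exact Finset.sum_comm)
    have hassoc : ∀ (s : ι → R) t, ∑ i, s i * ∑ j, A i j * B j t =
        ∑ j, (∑ i, s i * A i j) * B j t := by
      intro s t
      simp only [Finset.mul_sum, Finset.sum_mul, mul_assoc]
      exact Finset.sum_comm
    refine ⟨l, fun i t => ∑ j, A i j * B j t, z, ε, hz,
      fun i t => AddSubgroup.sum_mem _ fun j _ => mul_mem_shiftDegree h𝒜 (hA i j) (hB j t),
      fun i => ?_, fun s' hs' t => ?_⟩
    · rw [hxy]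
      simp only [hyz, Finset.smul_sum, Finset.sum_smul, mul_smul]
      exact Finset.sum_comm
    · rw [hassoc]
      rcases Finset.mem_insert.1 hs' with rfl | hs'
      · exact hsB t
      · simp [hSA s' hs']

/-- Writing the unknowns as sums of homogeneous elements and splitting each equation by degree
turns an arbitrary finite system into a finite homogeneous one. -/
theorem IsGrFlat.solvesEquationally [IsCancelMul Γ] (h𝒜 : IsGradedRing 𝒜)
    (hℱ : IsGradedLeftModule 𝒜 ℱ) (hF : IsGrFlat.{w, u, v, max u t} 𝒜 ℱ) :
    SolvesEquationally R F := by
  classical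
  intro ι _ S x hS
  have hxmem : x ∈ AddSubgroup.closure
      {z | ∃ k ∈ (⊤ : AddSubgroup (ι → R)), ∃ y, z = piSMul R F ι k y} := by
    rw [← sum_piSMul_single (R := R) x]
    exact AddSubgroup.sum_mem _ fun i _ =>
      AddSubgroup.subset_closure ⟨Pi.single i 1, trivial, x i, rfl⟩
  obtain ⟨n, k, y, δ, -, hy, hxy⟩ := exists_fin_sum_homogeneous
    (iSup_eq_top_of_isInternal hℱ.isInternal) _ _ hxmem
  have hxi : ∀ i, x i = ∑ j, k j i • y j := by
    intro i
    have := congrFun hxy i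
    simpa using this
  let q : (ι → R) → Fin n → R := fun s j => ∑ i, s i * k j i
  have hq : ∀ s ∈ S, ∑ j, q s j • y j = 0 := by
    intro s hs
    rw [← hS s hs]
    simp only [q, hxi, Finset.smul_sum, Finset.sum_smul, mul_smul]
    exact Finset.sum_comm
  choose T hT using fun (s : ι → R) (j : Fin n) => exists_sum_shiftProj h𝒜 (δ j) (q s j)
  let U : (ι → R) → Finset Γ := fun s => Finset.univ.biUnion (T s)
  obtain ⟨l, A, z, -, -, -, hyz, hA⟩ := exists_homogeneous_of_finset.{w, u, v, t} h𝒜 hℱ hF y δ hy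
    (S.biUnion fun s => (U s).image fun γ j => shiftProj h𝒜 γ (δ j) (q s j)) (by
      simp only [Finset.mem_biUnion, Finset.mem_image]
      rintro _ ⟨s, hs, γ, -, rfl⟩
      refine ⟨⟨γ, fun j => shiftProj_mem _ _ _ _⟩, ?_⟩
      simp only [← projOn_smul h𝒜 hℱ γ (q s _) (hy _)]
      rw [← map_sum, hq s hs, map_zero])
  refine ⟨l, fun i t => ∑ j, k j i * A j t, z, fun i => ?_, fun s hs t => ?_⟩
  · rw [hxi]
    simp only [hyz, Finset.smul_sum, Finset.sum_smul, mul_smul]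
    exact Finset.sum_comm
  · have hsplit : ∀ j, q s j = ∑ γ ∈ U s, shiftProj h𝒜 γ (δ j) (q s j) := fun j =>
      (hT s j _ (Finset.subset_biUnion_of_mem (T s) (Finset.mem_univ j))).symm
    calc ∑ i, s i * ∑ j, k j i * A j t = ∑ j, q s j * A j t := by
          simp only [q, Finset.mul_sum, Finset.sum_mul, mul_assoc]
          exact Finset.sum_comm
      _ = ∑ γ ∈ U s, ∑ j, shiftProj h𝒜 γ (δ j) (q s j) * A j t := by
          rw [Finset.sum_comm]
          refine Finset.sum_congr rfl fun j _ => ?_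
          rw [← Finset.sum_mul, ← hsplit j]
      _ = 0 := Finset.sum_eq_zero fun γ hγ =>
          hA _ (Finset.mem_biUnion.2 ⟨s, hs, Finset.mem_image_of_mem _ hγ⟩) t

end Graded

end MonoidGraded

/-- The modules that test flatness and gr-flatness may live in any two universes that contain a
copy of the ring. -/
theorem corollary3p8 {Γ : Type w} [Monoid Γ] [IsCancelMul Γ]
    {R : Type u} [Ring R] (𝒜 : Γ → AddSubgroup R) (h𝒜 : MonoidGraded.IsGradedRing 𝒜)
    {F : Type v} [AddCommGroup F] [Module R F] (ℱ : Γ → AddSubgroup F)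
    (hℱ : MonoidGraded.IsGradedLeftModule 𝒜 ℱ) :
    MonoidGraded.IsGrFlat.{w, u, v, max u t₁} 𝒜 ℱ ↔ MonoidGraded.IsFlat.{u, v, max u t₂} R F := by
  constructor
  · intro h
    exact MonoidGraded.isFlat_of_solvesEquationally
      (MonoidGraded.IsGrFlat.solvesEquationally.{w, u, v, t₁} h𝒜 hℱ h)
  · intro h
    -- The equational criterion mentions no test modules, so it moves flatness between universes.
    have hgr : MonoidGraded.IsGrFlat.{w, u, v, max u t₂} 𝒜 ℱ := h.isGrFlat
    have hflat : MonoidGraded.IsFlat.{u, v, max u t₁} R F :=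
      MonoidGraded.isFlat_of_solvesEquationally
        (MonoidGraded.IsGrFlat.solvesEquationally.{w, u, v, t₂} h𝒜 hℱ hgr)
    exact hflat.isGrFlat
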